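/- **Setting.** Let $H$ be an infinite-dimensional separable complex Hilbert space, $\mathcal Q(H)=\mathcal B(H)/\mathcal K(H)$ its Calkin algebra and $\pi\colon\mathcal B(H)\to\mathcal Q(H)$ the quotient map. Let $Z\subset\mathbb C$ be a closed set with $\sup_{z\in Z}\operatorname{Re}z<\infty$, put $X_n=\overline{\exp(2^{-n}Z)}$ for $n=0,1,2,\dots$, and let $$X=\varprojlim X_n=\Big\{(x_n)_{n\ge 0}\in\prod_{n\ge 0}X_n : x_{n+1}^2=x_n\text{ for all }n\Big\},$$ with coordinate projections $\pi_n\colon X\to X_n\subset\mathbb C$. Let $\mathrm{Ext}(X)$ be the set of unital $*$-monomorphisms $\tau\colon C(X)\to\mathcal Q(H)$ modulo the relation $\tau\sim\pi(W)^*\tau\,\pi(W)$, $W\in\mathcal B(H)$ unitary. Its zero element is $\Theta=[\pi\circ\sigma]$, where $\sigma(g)=\bigoplus_{i}g(\xi_i)I_{H_i}$ for an orthogonal decomposition $H=\bigoplus_{i\in\mathbb N}H_i$ into infinite-dimensional closed subspaces and a dense sequence $(\xi_i)_{i\in\mathbb N}$ in $X$. Let $\mathbb D=\{k2^{-m}:k,m\in\mathbb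 Z,\ k\ge 1,\ m\ge 0\}$ be the set of positive dyadic rationals. The dyadic semigroup induced by $\Theta=[\tau]$ is the unique family $(q(t))_{t\in\mathbb D}$ in $\mathcal Q(H)$ with $q(s+t)=q(s)q(t)$ for $s,t\in\mathbb D$ and $q(2^{-n})=\tau(\pi_n)$ for $n\ge 0$. For a non-principal ultrafilter $\mathcal U$ on $\mathbb N$, let $\mathbb H_{\mathcal U}$ be the Hilbert space completion of the space of weakly null sequences in $H$, modulo those with $\lim_{\mathcal U}\|x_n\|=0$, under the inner product $\lim_{n,\mathcal U}\langle x_n,y_n\rangle$. The $\mathcal U$-Calkin representation $\gamma_{\mathcal U}\colon\mathcal Q(H)\to\mathcal B(\mathbb H_{\mathcal U})$ is the $*$-representation determined by $\gamma_{\mathcal U}(\pi(T))[(x_n)]=[(Tx_n)]$. We call $(q(t))_{t\in\mathbb D}$ strongly continuous with respect to $\gamma_{\mathcal U}$ if there is a $C_0$-semigroup $(T(t))_{t\ge 0}$ on $\mathbb H_{\mathcal U}$ with $T(t)=\gamma_{\mathcal U}(q(t))$ for all $t\in\mathbb D$. **Theorem A.** Let $(q(t))_{t\in\mathbb D}$ be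 the dyadic semigroup induced by the zero element $\Theta\in\mathrm{Ext}(X)$, and let $\mathcal U$ be any fixed non-principal ultrafilter on $\mathbb N$. Then the following assertions are equivalent: (i) $(q(t))_{t\in\mathbb D}$ is strongly continuous with respect to the $\mathcal U$-Calkin representation; (ii) $(q(t))_{t\in\mathbb D}$ is strongly continuous with respect to the $\mathcal V$-Calkin representation for every non-principal ultrafilter $\mathcal V$ on $\mathbb N$; (iii) $\lim_{n\to\infty}\pi_n(\xi)=1$ for every $\xi\in X$. -/

import Mathlib

open Filter Topology
open scoped NNReal InnerProductSpace

noncomputable section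

universe u

set_option linter.unusedSectionVars false

/-! ## The Calkin algebra -/

namespace CalkinSG

variable (H : Type u) [NormedAddCommGroup H] [InnerProductSpace ℂ H] [CompleteSpace H]

/-- The ideal `K(H)` of compact operators in `B(H)`. -/
def compactIdeal : Ideal (H →L[ℂ] H) where
  carrier := {T | IsCompactOperator T}
  add_mem' hS hT := hS.add hT
  zero_mem' := isCompactOperator_zero
  smul_mem' S _ hT := hT.clm_comp S

variable {H} in
theorem mem_compactIdeal {T : H →L[ℂ] H} : T ∈ compactIdeal H ↔ IsCompactOperator T := Iff.rfl

instance compactIdeal_isTwoSided : (compactIdeal H).IsTwoSided :=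
  ⟨fun {_} S hT => IsCompactOperator.comp_clm hT S⟩

/-- The Calkin algebra `Q(H) = B(H)/K(H)`. -/
def CalkinAlgebra : Type u := (H →L[ℂ] H) ⧸ compactIdeal H

instance : Ring (CalkinAlgebra H) := inferInstanceAs (Ring ((H →L[ℂ] H) ⧸ compactIdeal H))

instance : Algebra ℂ (CalkinAlgebra H) :=
  inferInstanceAs (Algebra ℂ ((H →L[ℂ] H) ⧸ compactIdeal H))

/-- The quotient map `π : B(H) → Q(H)`. -/
def toCalkin : (H →L[ℂ] H) →ₐ[ℂ] CalkinAlgebra H := Ideal.Quotient.mkₐ ℂ (compactIdeal H)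

variable {H}

theorem toCalkin_surjective : Function.Surjective (toCalkin H) := Ideal.Quotient.mk_surjective

theorem toCalkin_eq_iff {S T : H →L[ℂ] H} :
    toCalkin H S = toCalkin H T ↔ IsCompactOperator (S - T) :=
  Ideal.Quotient.eq


/-- The adjoint of a compact operator is compact. -/
theorem isCompactOperator_star {T : H →L[ℂ] H} (hT : IsCompactOperator T) :
    IsCompactOperator (star T : H →L[ℂ] H) := by
  have hTT : IsCompactOperator (T * star T : H →L[ℂ] H) := hT.comp_clm (star T)
  have hc : TotallyBounded ((T * star T : H →L[ℂ] H) '' Metric.closedBall 0 1) :=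
    ((hTT.isCompact_closure_image_closedBall
      (f := ((T * star T : H →L[ℂ] H) : H →ₗ[ℂ] H)) 1).totallyBounded).subset subset_closure
  have htb : TotallyBounded ((star T : H →L[ℂ] H) '' Metric.closedBall 0 1) := by
    refine Metric.totallyBounded_iff.2 fun ε hε => ?_
    obtain ⟨t, hts, htf, htc⟩ :=
      Metric.finite_approx_of_totallyBounded hc (ε ^ 2 / 2) (by positivity)
    obtain ⟨t', ht's, ht'f, htc⟩ := Set.exists_subset_image_finite_and
      (p := fun t => (T * star T : H →L[ℂ] H) '' Metric.closedBall 0 1 ⊆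
        ⋃ y ∈ t, Metric.ball y (ε ^ 2 / 2)) |>.1 ⟨t, hts, htf, htc⟩
    refine ⟨(star T : H →L[ℂ] H) '' t', ht'f.image _, ?_⟩
    rintro _ ⟨x, hx, rfl⟩
    obtain ⟨_, ⟨y, hy, rfl⟩, hxy⟩ := Set.mem_iUnion₂.1 (htc ⟨x, hx, rfl⟩)
    refine Set.mem_iUnion₂.2 ⟨_, ⟨y, hy, rfl⟩, ?_⟩
    rw [Metric.mem_ball, dist_eq_norm, ← map_sub] at hxy ⊢
    have hn : ‖x - y‖ ≤ 2 := by
      have h1 := mem_closedBall_zero_iff.1 hx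
      have h2 := mem_closedBall_zero_iff.1 (ht's hy)
      linarith [norm_sub_le x y]
    have hsq : ‖(star T : H →L[ℂ] H) (x - y)‖ ^ 2 ≤ ‖(T * star T) (x - y)‖ * ‖x - y‖ := by
      have h := norm_inner_le_norm (𝕜 := ℂ) ((T * star T) (x - y)) (x - y)
      have h2 : inner ℂ ((T * star T) (x - y)) (x - y)
          = inner ℂ ((star T : H →L[ℂ] H) (x - y)) ((star T : H →L[ℂ] H) (x - y)) := by
        rw [ContinuousLinearMap.star_eq_adjoint, ContinuousLinearMap.adjoint_inner_right]
        rfl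
      rw [h2, inner_self_eq_norm_sq_to_K, norm_pow] at h
      simpa using h
    have : ‖(star T : H →L[ℂ] H) (x - y)‖ ^ 2 < ε ^ 2 := by
      nlinarith [norm_nonneg (x - y), norm_nonneg ((T * star T) (x - y))]
    exact lt_of_pow_lt_pow_left₀ 2 hε.le this
  exact ⟨_, isCompact_iff_totallyBounded_isComplete.2 ⟨htb.closure, isClosed_closure.isComplete⟩,
    mem_of_superset (Metric.closedBall_mem_nhds (0 : H) one_pos)
      fun x hx => subset_closure ⟨x, hx, rfl⟩⟩

instance : Star (CalkinAlgebra H) where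
  star := Quotient.lift (s := Submodule.quotientRel (compactIdeal H))
    (fun T => toCalkin H (star T)) (fun S T h => by
      have h' : IsCompactOperator (S - T) := (Submodule.quotientRel_def (compactIdeal H)).1 h
      rw [toCalkin_eq_iff, ← star_sub]
      exact isCompactOperator_star h')

theorem star_toCalkin (T : H →L[ℂ] H) : star (toCalkin H T) = toCalkin H (star T) := rfl

instance : StarRing (CalkinAlgebra H) where
  star_involutive a := by
    obtain ⟨S, rfl⟩ := toCalkin_surjective a
    simp [star_toCalkin]
  star_mul a b := by
    obtain ⟨S, rfl⟩ := toCalkin_surjective a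
    obtain ⟨T, rfl⟩ := toCalkin_surjective b
    simp only [star_toCalkin, ← map_mul, star_mul]
  star_add a b := by
    obtain ⟨S, rfl⟩ := toCalkin_surjective a
    obtain ⟨T, rfl⟩ := toCalkin_surjective b
    simp only [star_toCalkin, ← map_add, star_add]

/-! ## Extensions -/

section Extensions

variable (X : Type*) [TopologicalSpace X] (H)

/-- A Busby invariant: a unital `*`-monomorphism `C(X) → Q(H)`. -/
structure BusbyInvariant where
  /-- the underlying unital `*`-homomorphism -/
  toHom : C(X, ℂ) →⋆ₐ[ℂ] CalkinAlgebra H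
  injective : Function.Injective toHom

/-- Equivalence of extensions: `τ₂ = π(U)* τ₁ π(U)` for some unitary `U ∈ B(H)`. -/
instance BusbyInvariant.setoid : Setoid (BusbyInvariant H X) where
  r τ₁ τ₂ := ∃ U ∈ unitary (H →L[ℂ] H), ∀ g : C(X, ℂ),
    τ₂.toHom g = star (toCalkin H U) * τ₁.toHom g * toCalkin H U
  iseqv :=
    { refl := fun τ => ⟨1, one_mem _, fun g => by simp⟩
      symm := by
        rintro τ₁ τ₂ ⟨U, hU, h⟩
        refine ⟨star U, Unitary.star_mem hU, fun g => ?_⟩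
        have h1 : toCalkin H U * star (toCalkin H U) = 1 := by
          rw [star_toCalkin, ← map_mul, Unitary.mul_star_self_of_mem hU, map_one]
        rw [h, ← star_toCalkin, star_star]
        simp only [mul_assoc, h1, mul_one]
        rw [← mul_assoc, h1, one_mul]
      trans := by
        rintro τ₁ τ₂ τ₃ ⟨U, hU, h⟩ ⟨V, hV, h'⟩
        refine ⟨U * V, mul_mem hU hV, fun g => ?_⟩
        rw [h', h, map_mul, star_mul]
        simp only [mul_assoc] }

/-- `Ext(X)`: equivalence classes of Busby invariants, i.e. of extensions of `C(X)` by `K(H)`. -/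
def Ext := Quotient (BusbyInvariant.setoid H X)

variable {X} {H}

/-- `Γ = Θ`, the zero element of `Ext(X)`: there are an orthogonal decomposition
`H = ⨁ᵢ Kᵢ` into closed infinite-dimensional subspaces, a dense sequence `(ξᵢ)` in `X`, and the
`*`-homomorphism `σ(g) = ⨁ᵢ g(ξᵢ) Iᵢ` of `C(X)` into `B(H)`, such that `Γ = [π ∘ σ]`. -/
def Ext.IsZero (Γ : Ext H X) : Prop :=
  ∃ (K : ℕ → Submodule ℂ H) (ξ : ℕ → X) (σ : C(X, ℂ) →⋆ₐ[ℂ] (H →L[ℂ] H)) (τ : BusbyInvariant H X),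
    (∀ i, IsClosed (K i : Set H)) ∧ (∀ i, ¬ FiniteDimensional ℂ (K i)) ∧
    (∀ i j, i ≠ j → K i ⟂ K j) ∧ (⨆ i, K i).topologicalClosure = ⊤ ∧
    DenseRange ξ ∧
    (∀ (g : C(X, ℂ)) (i : ℕ), ∀ x ∈ K i, σ g x = g (ξ i) • x) ∧
    (∀ g : C(X, ℂ), τ.toHom g = toCalkin H (σ g)) ∧
    Γ = Quotient.mk _ τ

end Extensions

/-! ## Admissible spaces and dyadic semigroups -/

/-- `X_n`, the closure of `exp(2^{-n} Z)`. -/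
def admissibleStage (Z : Set ℂ) (n : ℕ) : Set ℂ :=
  closure ((fun z : ℂ => Complex.exp (((2 : ℂ) ^ n)⁻¹ * z)) '' Z)

/-- The inverse limit of the sets `X_n` along the maps `z ↦ z ^ 2`, with the topology induced by
the product topology. -/
def AdmissibleSpace (Z : Set ℂ) : Type :=
  {x : (n : ℕ) → admissibleStage Z n // ∀ n, (x (n + 1) : ℂ) ^ 2 = (x n : ℂ)}

instance (Z : Set ℂ) : TopologicalSpace (AdmissibleSpace Z) :=
  inferInstanceAs (TopologicalSpace
    {x : (n : ℕ) → admissibleStage Z n // ∀ n, (x (n + 1) : ℂ) ^ 2 = (x n : ℂ)})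

/-- The projection `π_n`, as an element of `C(X)`. -/
def proj (Z : Set ℂ) (n : ℕ) : C(AdmissibleSpace Z, ℂ) where
  toFun ξ := (ξ.1 n : ℂ)
  continuous_toFun :=
    continuous_subtype_val.comp ((continuous_apply n).comp continuous_subtype_val)

/-- The additive semigroup of positive dyadic rationals `k 2^{-m}`. -/
def Dyadics : AddSubsemigroup ℝ where
  carrier := {t | ∃ k m : ℕ, 0 < k ∧ t = (k : ℝ) / 2 ^ m}
  add_mem' := by
    rintro _ _ ⟨k, m, hk, rfl⟩ ⟨l, p, hl, rfl⟩
    refine ⟨k * 2 ^ p + l * 2 ^ m, m + p, by positivity, ?_⟩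
    push_cast
    rw [pow_add]
    field_simp

/-- The dyadic rational `2^{-n}`. -/
def twoPowNeg (n : ℕ) : Dyadics := ⟨((1 : ℕ) : ℝ) / 2 ^ n, 1, n, one_pos, rfl⟩

/-- `Γ ∈ Ext(X)` induces the dyadic semigroup `q`: for a Busby invariant `τ` of `Γ`, `q` is the
(unique) semigroup on the dyadic rationals with `q(2^{-n}) = τ(π_n)` for all `n`. -/
def Ext.Induces {Z : Set ℂ} (Γ : Ext H (AdmissibleSpace Z)) (q : Dyadics → CalkinAlgebra H) :
    Prop :=
  ∃ τ : BusbyInvariant H (AdmissibleSpace Z), Γ = Quotient.mk _ τ ∧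
    (∀ s t, q (s + t) = q s * q t) ∧ ∀ n, q (twoPowNeg n) = τ.toHom (proj Z n)

/-- `T : [0,∞) → B(E)` is a `C₀`-semigroup. -/
structure IsC0Semigroup {E : Type*} [NormedAddCommGroup E] [NormedSpace ℂ E]
    (T : ℝ≥0 → E →L[ℂ] E) : Prop where
  map_zero : T 0 = 1
  map_add : ∀ s t, T (s + t) = T s * T t
  continuous : ∀ x, Continuous fun t => T t x

/-- The dyadic semigroup `q` in `Q(H)` is strongly continuous (a `C₀`-semigroup) with respect to a
representation `γ` of `Q(H)` on `E`: some `C₀`-semigroup on `E` extends `(γ(q(t)))`. -/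
def IsStronglyContinuous {E : Type*} [NormedAddCommGroup E] [InnerProductSpace ℂ E]
    [CompleteSpace E] (γ : CalkinAlgebra H →⋆ₐ[ℂ] (E →L[ℂ] E)) (q : Dyadics → CalkinAlgebra H) :
    Prop :=
  ∃ T : ℝ≥0 → E →L[ℂ] E, IsC0Semigroup T ∧ ∀ t : Dyadics, T (t : ℝ).toNNReal = γ (q t)

/-! ## Calkin representations -/

variable (H) in
/-- The space of weakly null sequences in `H`. -/
def weaklyNull : Submodule ℂ (ℕ → H) where
  carrier := {x | ∀ y : H, Tendsto (fun n => inner ℂ y (x n)) atTop (𝓝 0)}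
  add_mem' hx hx' y := by simpa [inner_add_right] using (hx y).add (hx' y)
  zero_mem' y := by simp
  smul_mem' c x hx y := by simpa [inner_smul_right] using (hx y).const_mul c

/-- Weakly null sequences are bounded. -/
theorem weaklyNull_bounded (x : weaklyNull H) : ∃ C : ℝ, ∀ n, ‖x.1 n‖ ≤ C := by
  obtain ⟨C, hC⟩ := banach_steinhaus (g := fun n => innerSL ℂ (x.1 n)) fun y => by
    obtain ⟨C, hC⟩ := ((x.2 y).norm).bddAbove_range
    refine ⟨C, fun n => ?_⟩
    have := hC ⟨n, rfl⟩
    rw [innerSL_apply_apply, norm_inner_symm]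
    exact this
  exact ⟨C, fun n => by simpa using hC n⟩

/-- Non-principal ultrafilters on `ℕ`. -/
def NonprincipalUltrafilter : Type := {U : Ultrafilter ℕ // ∀ n, U ≠ pure n}

theorem NonprincipalUltrafilter.le_atTop (U : NonprincipalUltrafilter) :
    (U.1 : Filter ℕ) ≤ atTop := by
  rw [← Nat.cofinite_eq_atTop]
  exact U.1.le_cofinite_or_eq_pure.resolve_right fun ⟨n, hn⟩ => U.2 n hn

variable (H) in
/-- The space of weakly null sequences, to be normed with the help of the ultrafilter `U`. -/
def PreCalkin (_U : NonprincipalUltrafilter) : Type u := weaklyNull H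

variable (U : NonprincipalUltrafilter)

instance : AddCommGroup (PreCalkin H U) := inferInstanceAs (AddCommGroup (weaklyNull H))

instance : Module ℂ (PreCalkin H U) := inferInstanceAs (Module ℂ (weaklyNull H))

/-- `LIM_{n,U} ⟨x_n, y_n⟩`. -/
def limInner (x y : PreCalkin H U) : ℂ :=
  limUnder (U.1 : Filter ℕ) fun n => inner ℂ (x.1 n) (y.1 n)

theorem tendsto_limInner (x y : PreCalkin H U) :
    Tendsto (fun n => inner ℂ (x.1 n) (y.1 n)) (U.1 : Filter ℕ) (𝓝 (limInner U x y)) := by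
  obtain ⟨C, hC⟩ := weaklyNull_bounded (H := H) x
  obtain ⟨D, hD⟩ := weaklyNull_bounded (H := H) y
  have hmem : ∀ n, inner ℂ (x.1 n) (y.1 n) ∈ Metric.closedBall (0 : ℂ) (C * D) := fun n => by
    rw [mem_closedBall_zero_iff]
    exact (norm_inner_le_norm _ _).trans
      (mul_le_mul (hC n) (hD n) (norm_nonneg _) ((norm_nonneg _).trans (hC n)))
  obtain ⟨c, -, hc⟩ := (isCompact_closedBall (0 : ℂ) (C * D)).ultrafilter_le_nhds
    (U.1.map fun n => inner ℂ (x.1 n) (y.1 n))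
    (by
      rw [Ultrafilter.coe_map, le_principal_iff]
      exact Filter.mem_map.2 (Filter.univ_mem' hmem))
  exact tendsto_nhds_limUnder ⟨c, hc⟩

variable (H) in
/-- The semi-inner product `LIM_{n,U} ⟨x_n, y_n⟩` on weakly null sequences. -/
@[reducible]
def preCalkinCore : PreInnerProductSpace.Core ℂ (PreCalkin H U) where
  inner x y := limInner U x y
  conj_inner_symm x y := by
    refine tendsto_nhds_unique ?_ (tendsto_limInner U x y)
    have := (Complex.continuous_conj.tendsto _).comp (tendsto_limInner U y x)
    refine this.congr fun n => ?_
    simp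
  re_inner_nonneg x :=
    ge_of_tendsto' ((Complex.continuous_re.tendsto _).comp (tendsto_limInner U x x)) fun n =>
      inner_self_nonneg (𝕜 := ℂ)
  add_left x y z := by
    refine tendsto_nhds_unique (tendsto_limInner U (x + y) z) ?_
    refine ((tendsto_limInner U x z).add (tendsto_limInner U y z)).congr fun n => ?_
    exact (inner_add_left _ _ _).symm
  smul_left x y r := by
    refine tendsto_nhds_unique (tendsto_limInner U (r • x) y) ?_
    refine ((tendsto_limInner U x y).const_mul _).congr fun n => ?_
    exact (inner_smul_left _ _ _).symm

instance : SeminormedAddCommGroup (PreCalkin H U) :=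
  @InnerProductSpace.Core.toSeminormedAddCommGroup ℂ (PreCalkin H U) _ _ _ (preCalkinCore H U)

instance : InnerProductSpace ℂ (PreCalkin H U) := InnerProductSpace.ofCore (preCalkinCore H U)

theorem inner_preCalkin (x y : PreCalkin H U) : inner ℂ x y = limInner U x y := rfl

variable (H) in
/-- The Hilbert space of the Calkin representation: the Hausdorff completion of the space of
weakly null sequences, i.e. the completion of its quotient by the sequences with
`LIM_{n,U} ‖x_n‖ = 0`. -/
abbrev CalkinSpace : Type u := UniformSpace.Completion (PreCalkin H U)

/-- The operator `(x_n) ↦ (T x_n)` on weakly null sequences. -/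
def preCalkinMap (T : H →L[ℂ] H) : PreCalkin H U →L[ℂ] PreCalkin H U :=
  LinearMap.mkContinuous
    { toFun := fun x => ⟨fun n => T (x.1 n), fun y => by
        refine (x.2 (star T y)).congr fun n => ?_
        rw [ContinuousLinearMap.star_eq_adjoint, ContinuousLinearMap.adjoint_inner_left]⟩
      map_add' := fun x y => Subtype.ext (funext fun n => T.map_add _ _)
      map_smul' := fun c x => Subtype.ext (funext fun n => T.map_smul _ _) }
    ‖T‖ fun x => by
      refine abs_le_of_sq_le_sq' ?_ (by positivity) |>.2
      rw [mul_pow, ← inner_self_eq_norm_sq (𝕜 := ℂ), ← inner_self_eq_norm_sq (𝕜 := ℂ) x]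
      refine le_of_tendsto_of_tendsto'
        ((Complex.continuous_re.tendsto _).comp (tendsto_limInner U _ _))
        (((Complex.continuous_re.tendsto _).comp (tendsto_limInner U x x)).const_mul _) fun n => ?_
      have h := pow_le_pow_left₀ (norm_nonneg _) (T.le_opNorm (x.1 n)) 2
      rw [mul_pow, ← inner_self_eq_norm_sq (𝕜 := ℂ), ← inner_self_eq_norm_sq (𝕜 := ℂ) (x.1 n)] at h
      exact h

theorem preCalkinMap_apply (T : H →L[ℂ] H) (x : PreCalkin H U) (n : ℕ) :
    (preCalkinMap U T x).1 n = T (x.1 n) := rfl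

theorem preCalkinMap_ext {S T : CalkinSpace H U →L[ℂ] CalkinSpace H U}
    (h : ∀ x : PreCalkin H U, S x = T x) : S = T :=
  ContinuousLinearMap.ext fun x =>
    UniformSpace.Completion.induction_on x (isClosed_eq S.continuous T.continuous) h

variable (H) in
/-- The representation `Φ` of `B(H)` on `CalkinSpace H U`. -/
def calkinLift : (H →L[ℂ] H) →⋆ₐ[ℂ] (CalkinSpace H U →L[ℂ] CalkinSpace H U) where
  toFun T := (preCalkinMap U T).completion
  map_one' := preCalkinMap_ext U fun x => by
    rw [ContinuousLinearMap.completion_apply_coe]; rfl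
  map_mul' S T := preCalkinMap_ext U fun x => by
    rw [mul_apply_eq_comp]
    simp only [ContinuousLinearMap.completion_apply_coe]
    rfl
  map_zero' := preCalkinMap_ext U fun x => by
    rw [ContinuousLinearMap.completion_apply_coe]; rfl
  map_add' S T := preCalkinMap_ext U fun x => by
    rw [add_apply]
    simp only [ContinuousLinearMap.completion_apply_coe]
    rw [← UniformSpace.Completion.coe_add]
    rfl
  commutes' c := preCalkinMap_ext U fun x => by
    rw [ContinuousLinearMap.completion_apply_coe]
    exact UniformSpace.Completion.coe_smul c x
  map_star' T := by
    rw [ContinuousLinearMap.star_eq_adjoint (preCalkinMap U T).completion,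
      ContinuousLinearMap.eq_adjoint_iff]
    intro x y
    induction x, y using UniformSpace.Completion.induction_on₂ with
    | hp => exact isClosed_eq (by fun_prop) (by fun_prop)
    | ih x y =>
      rw [ContinuousLinearMap.completion_apply_coe, ContinuousLinearMap.completion_apply_coe,
        UniformSpace.Completion.inner_coe, UniformSpace.Completion.inner_coe]
      refine tendsto_nhds_unique (tendsto_limInner U (preCalkinMap U (star T) x) y) ?_
      refine (tendsto_limInner U x (preCalkinMap U T y)).congr fun n => ?_
      rw [preCalkinMap_apply, preCalkinMap_apply, ContinuousLinearMap.star_eq_adjoint,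
        ContinuousLinearMap.adjoint_inner_left]

theorem calkinLift_coe (T : H →L[ℂ] H) (x : PreCalkin H U) :
    calkinLift H U T x = (preCalkinMap U T x : CalkinSpace H U) :=
  ContinuousLinearMap.completion_apply_coe _ _

/-- A compact operator maps weakly null sequences to norm null sequences. -/
theorem tendsto_norm_of_isCompactOperator {T : H →L[ℂ] H} (hT : IsCompactOperator T)
    (x : weaklyNull H) : Tendsto (fun n => T (x.1 n)) atTop (𝓝 0) := by
  obtain ⟨C, hC⟩ := weaklyNull_bounded x
  have hK := hT.isCompact_closure_image_closedBall (f := (T : H →ₗ[ℂ] H)) C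
  refine tendsto_iff_ultrafilter _ _ _ |>.2 fun V hV => ?_
  obtain ⟨a, -, ha⟩ := hK.ultrafilter_le_nhds (V.map fun n => T (x.1 n))
    (by
      rw [Ultrafilter.coe_map, le_principal_iff]
      exact Filter.mem_map.2 (Filter.univ_mem' fun n =>
        subset_closure ⟨x.1 n, mem_closedBall_zero_iff.2 (hC n), rfl⟩))
  have ha' : Tendsto (fun n => T (x.1 n)) V (𝓝 a) := ha
  have h1 : Tendsto (fun n => inner ℂ a (T (x.1 n))) V (𝓝 (inner ℂ a a)) :=
    tendsto_const_nhds.inner ha'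
  have h2 : Tendsto (fun n => inner ℂ a (T (x.1 n))) V (𝓝 0) := by
    refine ((x.2 (ContinuousLinearMap.adjoint T a)).mono_left hV).congr fun n => ?_
    rw [ContinuousLinearMap.adjoint_inner_left]
  have h3 : a = 0 := inner_self_eq_zero.1 (tendsto_nhds_unique h1 h2)
  rw [← h3]
  exact ha'

theorem calkinLift_eq_zero {T : H →L[ℂ] H} (hT : IsCompactOperator T) : calkinLift H U T = 0 :=
  preCalkinMap_ext U fun x => by
    rw [calkinLift_coe, zero_apply, ← norm_eq_zero,
      UniformSpace.Completion.norm_coe, ← sq_eq_zero_iff, ← inner_self_eq_norm_sq (𝕜 := ℂ)]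
    have h : limInner U (preCalkinMap U T x) (preCalkinMap U T x) = 0 := by
      refine tendsto_nhds_unique (tendsto_limInner U _ _) ?_
      have h0 := (tendsto_norm_of_isCompactOperator hT x).mono_left U.le_atTop
      have h1 := h0.inner (𝕜 := ℂ) h0
      rw [inner_zero_left] at h1
      exact h1
    rw [inner_preCalkin, h]
    rfl

variable (H) in
/-- The `U`-Calkin representation `γ(π(T)) = Φ(T)` of the Calkin algebra. -/
def calkinRep : CalkinAlgebra H →⋆ₐ[ℂ] (CalkinSpace H U →L[ℂ] CalkinSpace H U) where
  __ : CalkinAlgebra H →ₐ[ℂ] (CalkinSpace H U →L[ℂ] CalkinSpace H U) :=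
    Ideal.Quotient.liftₐ (compactIdeal H) (calkinLift H U).toAlgHom fun _ hT =>
      calkinLift_eq_zero U hT
  map_star' a := by
    obtain ⟨T, rfl⟩ := toCalkin_surjective a
    exact map_star (calkinLift H U) T

theorem calkinRep_toCalkin (T : H →L[ℂ] H) : calkinRep H U (toCalkin H T) = calkinLift H U T := rfl

end CalkinSG

end

/-!
Let `τ` represent the extension and `γ` be a Calkin representation. Everything is read off from the
representation `γ ∘ τ` of `C(X)`, in which `q(k 2⁻ᵐ)` becomes the image of `π_m ^ k`.

If `π_n(ξ) → 1`, then the coordinates of `ξ` are eventually principal square roots of one another,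
so that `π_n(ξ) = exp(2⁻ⁿ z)` for some `z` depending on `ξ` (`exists_eq_exp_of_tendsto_one`).
Hence, if this holds at every `ξ`, the function on `X` that represents `q(t)` takes the values
`exp(t z)`; it tends to `1` pointwise as `t → 0`, and it is bounded by `exp(M t)` if `Re ≤ M` on
`Z`. The exponents `z` may be unbounded on `X`, so the convergence need not be uniform, but
dominated convergence for the spectral measures of vectors gives strong convergence
(`tendsto_rep_apply_of_bounded`). A dyadic semigroup that is exponentially bounded and strongly
continuous at `0` extends to `[0, ∞)` (`exists_isC0Semigroup`). This direction works for every
extension and every ultrafilter.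

Conversely, for the zero element every `ξ` is a joint eigenvalue of `γ ∘ τ`: orthonormal vectors
taken from the summands of points `ξ_{i_k} → ξ` form a weakly null sequence whose class is an
eigenvector (`Ext.IsZero.exists_eigenvector`). Applied to this vector, strong continuity at `0`
says that `π_n(ξ) → 1`.
-/

namespace CalkinSG

/-! ### Extending a dyadic semigroup to a `C₀`-semigroup -/

/-- The inclusion of the positive dyadic rationals into `[0, ∞)`. -/
noncomputable def Dyadics.toNNReal (t : Dyadics) : ℝ≥0 := (t : ℝ).toNNReal

theorem Dyadics.coe_pos (t : Dyadics) : 0 < (t : ℝ) := by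
  obtain ⟨k, m, hk, h⟩ := t.2
  rw [h]
  positivity

theorem Dyadics.coe_toNNReal (t : Dyadics) : (Dyadics.toNNReal t : ℝ) = t :=
  Real.coe_toNNReal _ (Dyadics.coe_pos t).le

theorem Dyadics.toNNReal_add (s t : Dyadics) :
    Dyadics.toNNReal (s + t) = Dyadics.toNNReal s + Dyadics.toNNReal t :=
  Real.toNNReal_add (Dyadics.coe_pos s).le (Dyadics.coe_pos t).le

theorem Dyadics.isDenseInducing_toNNReal : IsDenseInducing Dyadics.toNNReal where
  eq_induced := by
    have h : IsInducing ((fun t : ℝ≥0 => (t : ℝ)) ∘ Dyadics.toNNReal) := by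
      have : (fun t : ℝ≥0 => (t : ℝ)) ∘ Dyadics.toNNReal = Subtype.val :=
        funext Dyadics.coe_toNNReal
      rw [this]
      exact IsInducing.subtypeVal
    exact (h.of_comp (continuous_real_toNNReal.comp continuous_subtype_val)
      NNReal.continuous_coe).eq_induced
  dense := by
    intro b
    have h2 : Tendsto (fun n : ℕ => (2 : ℝ) ^ n) atTop atTop :=
      tendsto_pow_atTop_atTop_of_one_lt one_lt_two
    -- `(⌊2ⁿ b⌋ + 1) / 2ⁿ` is a positive dyadic rational in `(b, b + 2⁻ⁿ]`
    let d : ℕ → Dyadics := fun n =>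
      ⟨((⌊(2 : ℝ) ^ n * b⌋₊ + 1 : ℕ) : ℝ) / 2 ^ n, _, n, Nat.succ_pos _, rfl⟩
    refine mem_closure_of_tendsto (f := fun n => Dyadics.toNNReal (d n)) (b := atTop) ?_
      (Eventually.of_forall fun n => ⟨_, rfl⟩)
    rw [← NNReal.tendsto_coe]
    simp only [Dyadics.coe_toNNReal]
    have h3 : Tendsto (fun n : ℕ => (b : ℝ) + 1 / 2 ^ n) atTop (𝓝 b) := by
      simpa using (tendsto_const_nhds (x := (b : ℝ))).add
        (tendsto_const_nhds (x := (1 : ℝ)) |>.div_atTop h2)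
    refine tendsto_of_tendsto_of_tendsto_of_le_of_le tendsto_const_nhds h3 (fun n => ?_)
      fun n => ?_
    · have := (Nat.lt_floor_add_one ((2 : ℝ) ^ n * b)).le
      change (b : ℝ) ≤ ((⌊(2 : ℝ) ^ n * b⌋₊ + 1 : ℕ) : ℝ) / 2 ^ n
      rw [le_div_iff₀ (by positivity)]
      push_cast
      linarith
    · have := Nat.floor_le (a := (2 : ℝ) ^ n * b) (by positivity)
      change ((⌊(2 : ℝ) ^ n * b⌋₊ + 1 : ℕ) : ℝ) / 2 ^ n ≤ (b : ℝ) + 1 / 2 ^ n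
      rw [div_le_iff₀ (by positivity), add_mul, one_div_mul_cancel (by positivity)]
      push_cast
      linarith

section Extension

variable {E : Type*} [NormedAddCommGroup E] [NormedSpace ℂ E] {Q : Dyadics → E →L[ℂ] E}

theorem Dyadics.exists_add_eq {s t : Dyadics} (h : (s : ℝ) < t) :
    ∃ r : Dyadics, t = s + r ∧ (r : ℝ) = t - s := by
  obtain ⟨k, m, hk, hs⟩ := s.2
  obtain ⟨l, p, hl, ht⟩ := t.2
  have key : (t : ℝ) - s = ((l * 2 ^ m - k * 2 ^ p : ℕ) : ℝ) / 2 ^ (m + p) := by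
    have : k * 2 ^ p < l * 2 ^ m := by
      rw [hs, ht, div_lt_div_iff₀ (by positivity) (by positivity)] at h
      exact_mod_cast h
    rw [Nat.cast_sub this.le, hs, ht, pow_add]
    push_cast
    field_simp
  refine ⟨⟨t - s, l * 2 ^ m - k * 2 ^ p, m + p, ?_, key⟩, Subtype.ext ?_, rfl⟩
  · by_contra h0
    rw [Nat.eq_zero_of_not_pos h0] at key
    simp only [Nat.cast_zero, zero_div] at key
    linarith
  · simp

/-- Orbits of a dyadic semigroup are uniformly continuous on bounded sets once they are continuous
at `0`, hence have limits at every point of `[0, ∞)`. -/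
theorem exists_tendsto_orbit [CompleteSpace E] {M : ℝ} (hM : 0 ≤ M)
    (hadd : ∀ s t, Q (s + t) = Q s * Q t) (hbd : ∀ t : Dyadics, ‖Q t‖ ≤ Real.exp (M * t))
    (hcont : ∀ x, Tendsto (fun t => Q t x) (comap Dyadics.toNNReal (𝓝 0)) (𝓝 x))
    (x : E) (b : ℝ≥0) :
    ∃ c, Tendsto (fun t => Q t x) (comap Dyadics.toNNReal (𝓝 b)) (𝓝 c) := by
  have : (comap Dyadics.toNNReal (𝓝 b)).NeBot :=
    Dyadics.isDenseInducing_toNNReal.comap_nhds_neBot b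
  refine cauchy_map_iff_exists_tendsto.1 (Metric.cauchy_iff.2 ⟨inferInstance, fun ε hε => ?_⟩)
  set C := Real.exp (M * (b + 1)) with hC
  have hC0 : 0 < C := Real.exp_pos _
  have h0 := (hcont x).eventually (Metric.ball_mem_nhds x (div_pos hε hC0))
  rw [eventually_comap, Metric.eventually_nhds_iff] at h0
  obtain ⟨δ, hδ, hQ⟩ := h0
  have key : ∀ s t : Dyadics, (s : ℝ) < b + 1 → (s : ℝ) < t → (t : ℝ) - s < δ →
      dist (Q t x) (Q s x) < ε := by
    intro s t hs hst hd
    obtain ⟨r, rfl, hr⟩ := Dyadics.exists_add_eq hst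
    have h1 : ‖Q r x - x‖ < ε / C := by
      rw [← dist_eq_norm]
      refine hQ (y := Dyadics.toNNReal r) ?_ r rfl
      rw [NNReal.dist_eq, Dyadics.coe_toNNReal, NNReal.coe_zero, sub_zero,
        abs_of_pos (Dyadics.coe_pos r), hr]
      exact hd
    have h2 : ‖Q s‖ ≤ C := (hbd s).trans (Real.exp_le_exp.2 (by gcongr))
    rw [dist_eq_norm, hadd, mul_apply_eq_comp, ← map_sub]
    calc ‖Q s (Q r x - x)‖ ≤ ‖Q s‖ * ‖Q r x - x‖ := (Q s).le_opNorm _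
      _ ≤ C * ‖Q r x - x‖ := by gcongr
      _ < C * (ε / C) := by gcongr
      _ = ε := mul_div_cancel₀ _ hC0.ne'
  refine ⟨_, image_mem_map (preimage_mem_comap (Metric.ball_mem_nhds b
    (lt_min (half_pos hδ) one_pos))), ?_⟩
  rintro _ ⟨s, hs, rfl⟩ _ ⟨t, ht, rfl⟩
  simp only [Set.mem_preimage, Metric.mem_ball, NNReal.dist_eq, Dyadics.coe_toNNReal, lt_min_iff,
    abs_lt] at hs ht
  rcases lt_trichotomy (s : ℝ) t with h | h | h
  · rw [dist_comm]
    exact key s t (by linarith [hs.2.2]) h (by linarith [hs.1.1, ht.1.2])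
  · rw [Subtype.ext h, dist_self]
    exact hε
  · exact key t s (by linarith [ht.2.2]) h (by linarith [ht.1.1, hs.1.2])

/-- An exponentially bounded dyadic semigroup that is strongly continuous at `0` extends to a
`C₀`-semigroup. -/
theorem exists_isC0Semigroup [CompleteSpace E] {M : ℝ} (hM : 0 ≤ M)
    (hadd : ∀ s t, Q (s + t) = Q s * Q t) (hbd : ∀ t : Dyadics, ‖Q t‖ ≤ Real.exp (M * t))
    (hcont : ∀ x, Tendsto (fun t => Q t x) (comap Dyadics.toNNReal (𝓝 0)) (𝓝 x)) :
    ∃ T : ℝ≥0 → E →L[ℂ] E, IsC0Semigroup T ∧ ∀ t : Dyadics, T (Dyadics.toNNReal t) = Q t := by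
  have di := Dyadics.isDenseInducing_toNNReal
  have hlim := exists_tendsto_orbit hM hadd hbd hcont
  choose L hL using hlim
  have hne : ∀ b, (comap Dyadics.toNNReal (𝓝 b)).NeBot := di.comap_nhds_neBot
  have hLext : ∀ x, L x = di.extend fun t => Q t x := fun x =>
    funext fun b => (di.extend_eq_of_tendsto (hL x b)).symm
  have hLcont : ∀ x, Continuous (L x) := fun x => by
    rw [hLext]
    exact di.continuous_extend fun b => ⟨_, hL x b⟩
  have hLQ : ∀ x (t : Dyadics), L x (Dyadics.toNNReal t) = Q t x := fun x t => by
    have h := hL x (Dyadics.toNNReal t)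
    rw [← di.nhds_eq_comap] at h
    exact tendsto_nhds_unique (tendsto_pure_nhds (fun t => Q t x) t)
      (h.mono_left (pure_le_nhds t)) |>.symm
  let T : ℝ≥0 → E →L[ℂ] E := fun b => LinearMap.mkContinuous
    { toFun := fun x => L x b
      map_add' := fun x y => tendsto_nhds_unique (hL (x + y) b)
        (((hL x b).add (hL y b)).congr fun t => (map_add (Q t) x y).symm)
      map_smul' := fun c x => tendsto_nhds_unique (hL (c • x) b)
        (((hL x b).const_smul c).congr fun t => (map_smul (Q t) c x).symm) }
    (Real.exp (M * b)) fun x => by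
      have hb : Tendsto (fun t : Dyadics => (t : ℝ)) (comap Dyadics.toNNReal (𝓝 b)) (𝓝 b) :=
        (((NNReal.continuous_coe.tendsto b).comp tendsto_comap)).congr Dyadics.coe_toNNReal
      refine le_of_tendsto_of_tendsto' (hL x b).norm
        (((Real.continuous_exp.tendsto _).comp (hb.const_mul M)).mul_const ‖x‖) fun t => ?_
      exact (Q t).le_of_opNorm_le (hbd t) x
  have hTQ : ∀ t : Dyadics, T (Dyadics.toNNReal t) = Q t := fun t =>
    ContinuousLinearMap.ext fun x => hLQ x t
  have hTcont : ∀ x, Continuous fun t => T t x := hLcont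
  refine ⟨T, ⟨?_, ?_, hTcont⟩, hTQ⟩
  · exact ContinuousLinearMap.ext fun x => tendsto_nhds_unique (hL x 0) (hcont x)
  · -- both sides are separately continuous and agree on dyadic arguments
    have h1 : ∀ (s : Dyadics) (t : ℝ≥0), T (Dyadics.toNNReal s + t) = T (Dyadics.toNNReal s) * T t := by
      intro s t
      ext x
      refine congrFun (di.dense.equalizer (g := fun t : ℝ≥0 => T (Dyadics.toNNReal s + t) x)
        (h := fun t : ℝ≥0 => (T (Dyadics.toNNReal s) * T t) x) ((hTcont x).comp (continuous_const_add _))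
        ((T (Dyadics.toNNReal s)).continuous.comp (hTcont x)) (funext fun r => ?_)) t
      simp only [Function.comp_apply]
      rw [← Dyadics.toNNReal_add, hTQ, hTQ, hTQ, hadd]
    intro s t
    ext x
    exact congrFun (di.dense.equalizer (g := fun s : ℝ≥0 => T (s + t) x)
      (h := fun s : ℝ≥0 => (T s * T t) x) ((hTcont x).comp (continuous_add_const _))
      (hTcont (T t x)) (funext fun r => by simp only [Function.comp_apply, h1])) s

end Extension

/-! ### Points of the inverse limit as one-parameter semigroups -/

/-- A coherent sequence of square roots that converges to `1` consists, from some index on, of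
principal square roots, and is therefore of the form `exp(2⁻ⁿ z)`. -/
theorem exists_eq_exp_of_tendsto_one {x : ℕ → ℂ} (hsq : ∀ n, x (n + 1) ^ 2 = x n)
    (hx : Tendsto x atTop (𝓝 1)) : ∃ z : ℂ, ∀ n, x n = Complex.exp (z / 2 ^ n) := by
  have hpow : ∀ n k, x n = x (n + k) ^ 2 ^ k := by
    intro n k
    induction k with
    | zero => simp
    | succ k ih => rw [ih, ← hsq (n + k), ← pow_mul, pow_succ' 2 k]; rfl
  have hev : ∀ᶠ n in atTop, 0 < (x n).re :=
    ((Complex.continuous_re.tendsto _).comp hx).eventually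
      (lt_mem_nhds (by simp))
  obtain ⟨N, hN⟩ := eventually_atTop.1 hev
  have hlog : ∀ n, N ≤ n → 2 * Complex.log (x (n + 1)) = Complex.log (x n) := by
    intro n hn
    have hre := hN (n + 1) (by omega)
    have harg := abs_lt.1 (Complex.abs_arg_lt_pi_div_two_iff.2 (Or.inl hre))
    have h0 : x (n + 1) ≠ 0 := fun h => by simp [h] at hre
    have him : (2 * Complex.log (x (n + 1))).im = 2 * (x (n + 1)).arg := by
      simp [Complex.log_im]
    rw [← hsq n, ← Complex.log_exp (x := 2 * Complex.log (x (n + 1))), two_mul, Complex.exp_add,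
      Complex.exp_log h0, sq]
    · rw [him]; linarith [harg.1]
    · rw [him]; linarith [harg.2]
  have hz : ∀ k, Complex.log (x (N + k)) = 2 ^ N * Complex.log (x N) / 2 ^ (N + k) := by
    intro k
    induction k with
    | zero => rw [add_zero, mul_div_cancel_left₀ _ (pow_ne_zero N two_ne_zero)]
    | succ k ih =>
      have := hlog (N + k) (by omega)
      rw [ih] at this
      have h2 : ∀ n : ℕ, (2 : ℂ) ^ n ≠ 0 := fun n => pow_ne_zero n two_ne_zero
      rw [eq_div_iff (h2 _)] at this ⊢
      rw [← this]
      simp only [← add_assoc, pow_succ]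
      ring_nf
  refine ⟨2 ^ N * Complex.log (x N), fun n => ?_⟩
  have h0 : x (N + n) ≠ 0 := fun h => by
    have := hN (N + n) (by omega)
    simp [h] at this
  rw [hpow n N, add_comm n N, ← Complex.exp_log h0, hz, ← Complex.exp_nat_mul]
  congr 1
  push_cast
  rw [pow_add]
  field_simp

/-- `X_n` lies in the disc of radius `exp(2⁻ⁿ M)` if `Re z ≤ M` on `Z`. -/
theorem norm_le_of_mem_admissibleStage {Z : Set ℂ} {M : ℝ} (hM : ∀ z ∈ Z, z.re ≤ M) {n : ℕ}
    {w : ℂ} (hw : w ∈ admissibleStage Z n) : ‖w‖ ≤ Real.exp (M / 2 ^ n) := by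
  refine closure_minimal (t := {w : ℂ | ‖w‖ ≤ Real.exp (M / 2 ^ n)}) ?_
    (isClosed_le continuous_norm continuous_const) hw
  rintro _ ⟨z, hz, rfl⟩
  have h : ((2 : ℂ) ^ n)⁻¹ = ((((2 : ℝ) ^ n)⁻¹ : ℝ) : ℂ) := by push_cast; rfl
  rw [Set.mem_ofPred_eq, Complex.norm_exp, Real.exp_le_exp, h, Complex.re_ofReal_mul,
    inv_mul_eq_div]
  gcongr
  exact hM z hz

theorem proj_succ_sq {Z : Set ℂ} (n : ℕ) (ξ : AdmissibleSpace Z) :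
    proj Z (n + 1) ξ ^ 2 = proj Z n ξ := ξ.2 n

theorem norm_proj_le {Z : Set ℂ} {M : ℝ} (hM : ∀ z ∈ Z, z.re ≤ M) (n : ℕ)
    (ξ : AdmissibleSpace Z) : ‖proj Z n ξ‖ ≤ Real.exp (M / 2 ^ n) :=
  norm_le_of_mem_admissibleStage hM (ξ.1 n).2

theorem AdmissibleSpace.compactSpace {Z : Set ℂ} {M : ℝ} (hM : ∀ z ∈ Z, z.re ≤ M) :
    CompactSpace (AdmissibleSpace Z) := by
  have : ∀ n, CompactSpace (admissibleStage Z n) := fun n =>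
    isCompact_iff_compactSpace.1 <| Metric.isCompact_of_isClosed_isBounded isClosed_closure <|
      Metric.isBounded_closedBall.subset fun w hw =>
        mem_closedBall_zero_iff.2 (norm_le_of_mem_admissibleStage hM hw)
  have hcl : IsClosed {x : (n : ℕ) → admissibleStage Z n |
      ∀ n, (x (n + 1) : ℂ) ^ 2 = (x n : ℂ)} := by
    simp only [Set.ofPred_forall]
    exact isClosed_iInter fun n => isClosed_eq (by fun_prop) (by fun_prop)
  exact isCompact_iff_compactSpace.1 hcl.isCompact

instance (Z : Set ℂ) : T2Space (AdmissibleSpace Z) :=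
  inferInstanceAs (T2Space {x : (n : ℕ) → admissibleStage Z n //
    ∀ n, (x (n + 1) : ℂ) ^ 2 = (x n : ℂ)})

instance (Z : Set ℂ) : SecondCountableTopology (AdmissibleSpace Z) :=
  (IsInducing.subtypeVal : IsInducing (Subtype.val : AdmissibleSpace Z →
    (n : ℕ) → admissibleStage Z n)).secondCountableTopology

/-! ### Dominated convergence for representations of `C(X)` -/

/-- Dominated convergence: pointwise convergence of a uniformly bounded family in `C(X)` implies
strong convergence in every representation. The proof integrates against the measure `μ` with
`‖ρ(g) x‖² = ∫ |g|² dμ`, which the Riesz–Markov–Kakutani theorem provides. -/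
theorem tendsto_rep_apply_of_bounded {X E ι : Type*} [TopologicalSpace X] [CompactSpace X]
    [T2Space X] [NormedAddCommGroup E] [InnerProductSpace ℂ E] [CompleteSpace E]
    (ρ : C(X, ℂ) →⋆ₐ[ℂ] (E →L[ℂ] E)) {l : Filter ι} [l.IsCountablyGenerated]
    {g : ι → C(X, ℂ)} {C : ℝ} (hC : ∀ᶠ i in l, ∀ ξ, ‖g i ξ‖ ≤ C)
    (hg : ∀ ξ, Tendsto (fun i => g i ξ) l (𝓝 1)) (x : E) :
    Tendsto (fun i => ρ (g i) x) l (𝓝 x) := by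
  let ofR : C(X, ℝ) → C(X, ℂ) := fun h => ⟨fun ξ => (h ξ : ℂ), by fun_prop⟩
  have hstar : ∀ g : C(X, ℂ), ‖ρ g x‖ ^ 2 = (inner ℂ x (ρ (star g * g) x)).re := by
    intro g
    rw [map_mul, map_star, mul_apply_eq_comp, ContinuousLinearMap.star_eq_adjoint,
      ContinuousLinearMap.adjoint_inner_right, ← inner_self_eq_norm_sq (𝕜 := ℂ)]
    rfl
  let Λ : CompactlySupportedContinuousMap X ℝ →ₚ[ℝ] ℝ := PositiveLinearMap.mk₀
    { toFun := fun h => (inner ℂ x (ρ (ofR h) x)).re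
      map_add' := fun h k => by
        have : ofR ((h + k : CompactlySupportedContinuousMap X ℝ) : C(X, ℝ))
            = ofR h + ofR k := by
          ext ξ; simp [ofR]
        rw [this, map_add, add_apply, inner_add_right, Complex.add_re]
      map_smul' := fun c h => by
        have : ofR ((c • h : CompactlySupportedContinuousMap X ℝ) : C(X, ℝ))
            = (c : ℂ) • ofR h := by
          ext ξ; simp [ofR]
        rw [this, map_smul, smul_apply, inner_smul_right,
          Complex.re_ofReal_mul]
        rfl } fun h hh => by
      let r : C(X, ℂ) := ofR ⟨fun ξ => Real.sqrt (h ξ), by fun_prop⟩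
      have hr : ofR h = star r * r := by
        ext ξ
        have : ((Real.sqrt (h ξ) : ℝ) : ℂ) * (Real.sqrt (h ξ) : ℝ) = (h ξ : ℂ) := by
          rw [← Complex.ofReal_mul, Real.mul_self_sqrt (hh ξ)]
        simpa [ofR, r] using this.symm
      change 0 ≤ (inner ℂ x (ρ (ofR h) x)).re
      rw [hr, ← hstar]
      positivity
  let _ : MeasurableSpace X := borel X
  have : BorelSpace X := ⟨rfl⟩
  let μ := RealRMK.rieszMeasure Λ
  have hμ : ∀ g : C(X, ℂ), ‖ρ g x‖ ^ 2 = ∫ ξ, ‖g ξ‖ ^ 2 ∂μ := by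
    intro g
    let h : CompactlySupportedContinuousMap X ℝ :=
      CompactlySupportedContinuousMap.continuousMapEquiv ⟨fun ξ => ‖g ξ‖ ^ 2, by fun_prop⟩
    have h1 : ofR h = star g * g := by
      ext ξ
      have : ((‖g ξ‖ ^ 2 : ℝ) : ℂ) = (starRingEnd ℂ) (g ξ) * g ξ := by
        rw [Complex.conj_mul']; push_cast; rfl
      exact this
    have h2 : ∫ ξ, h ξ ∂μ = (inner ℂ x (ρ (ofR h) x)).re := RealRMK.integral_rieszMeasure Λ h
    rw [h1, ← hstar] at h2
    exact h2.symm
  have hlim : Tendsto (fun i => ∫ ξ, ‖(g i - 1) ξ‖ ^ 2 ∂μ) l (𝓝 (∫ _, 0 ∂μ)) := by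
    refine MeasureTheory.tendsto_integral_filter_of_dominated_convergence
      (fun _ => (C + 1) ^ 2) (Eventually.of_forall fun i => ?_) ?_ ?_ ?_
    · exact (by fun_prop : Continuous fun ξ => ‖(g i - 1) ξ‖ ^ 2).aestronglyMeasurable
    · filter_upwards [hC] with i hi
      refine Eventually.of_forall fun ξ => ?_
      rw [norm_pow, norm_norm]
      gcongr
      refine (norm_sub_le (g i ξ) 1).trans ?_
      rw [norm_one]
      gcongr
      exact hi ξ
    · have : MeasureTheory.IsFiniteMeasure μ := inferInstance
      exact MeasureTheory.integrable_const _
    · refine Eventually.of_forall fun ξ => ?_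
      have := (((hg ξ).sub_const 1).norm.pow 2)
      rw [sub_self, norm_zero, zero_pow two_ne_zero] at this
      exact this
  rw [MeasureTheory.integral_zero] at hlim
  rw [tendsto_iff_norm_sub_tendsto_zero]
  have h2 : ∀ i, ‖ρ (g i) x - x‖ = Real.sqrt (∫ ξ, ‖(g i - 1) ξ‖ ^ 2 ∂μ) := fun i => by
    rw [← hμ, Real.sqrt_sq (norm_nonneg _), map_sub, map_one]
    rfl
  simp only [h2]
  have h3 := (Real.continuous_sqrt.tendsto 0).comp hlim
  rwa [Real.sqrt_zero] at h3

/-! ### Strong continuity from pointwise convergence -/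

section

universe u
variable {H : Type u} [NormedAddCommGroup H] [InnerProductSpace ℂ H] [CompleteSpace H]

theorem dyadic_eq_pow {A : Type*} [Monoid A] {q : Dyadics → A}
    (hadd : ∀ s t, q (s + t) = q s * q t) {t : Dyadics} {k m : ℕ} (hk : 0 < k)
    (ht : (t : ℝ) = (k : ℝ) / 2 ^ m) : q t = q (twoPowNeg m) ^ k := by
  induction k, hk using Nat.le_induction generalizing t with
  | base =>
    rw [pow_one]
    exact congrArg q (Subtype.ext ht)
  | succ k hk ih =>
    have hs : ((⟨(k : ℝ) / 2 ^ m, k, m, hk, rfl⟩ : Dyadics) : ℝ) = (k : ℝ) / 2 ^ m := rfl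
    have : t = ⟨(k : ℝ) / 2 ^ m, k, m, hk, rfl⟩ + twoPowNeg m := by
      refine Subtype.ext ?_
      change (t : ℝ) = (k : ℝ) / 2 ^ m + ((1 : ℕ) : ℝ) / 2 ^ m
      rw [ht]
      push_cast
      ring
    rw [this, hadd, ih hs, pow_succ]

/-- If `π_n → 1` pointwise, then the dyadic semigroup of any extension, trivial or not, is strongly
continuous. Pointwise, `q(t)` is `exp(t z)` with `z` depending on the point, which tends to `1` as
`t → 0`; dominated convergence turns this into strong convergence. -/
theorem isStronglyContinuous_of_tendsto {Z : Set ℂ} (hbdd : BddAbove (Complex.re '' Z))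
    {q : Dyadics → CalkinAlgebra H} (hadd : ∀ s t, q (s + t) = q s * q t)
    {τ : C(AdmissibleSpace Z, ℂ) →⋆ₐ[ℂ] CalkinAlgebra H}
    (hq : ∀ n, q (twoPowNeg n) = τ (proj Z n))
    (hlim : ∀ ξ : AdmissibleSpace Z, Tendsto (fun n => proj Z n ξ) atTop (𝓝 1))
    (V : NonprincipalUltrafilter) : IsStronglyContinuous (calkinRep H V) q := by
  obtain ⟨M, hM0, hM⟩ : ∃ M : ℝ, 0 ≤ M ∧ ∀ z ∈ Z, z.re ≤ M := by
    obtain ⟨M, hM⟩ := hbdd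
    exact ⟨max 0 M, le_max_left _ _, fun z hz => (hM ⟨z, hz, rfl⟩).trans (le_max_right _ _)⟩
  have := AdmissibleSpace.compactSpace hM
  let ρ : C(AdmissibleSpace Z, ℂ) →⋆ₐ[ℂ] (CalkinSpace H V →L[ℂ] CalkinSpace H V) :=
    (calkinRep H V).comp τ
  have hpt : ∀ ξ : AdmissibleSpace Z, ∃ z : ℂ, ∀ n, proj Z n ξ = Complex.exp (z / 2 ^ n) :=
    fun ξ => exists_eq_exp_of_tendsto_one (fun n => proj_succ_sq n ξ) (hlim ξ)
  choose z hz using hpt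
  have hg : ∀ t : Dyadics, ∃ g : C(AdmissibleSpace Z, ℂ), q t = τ g ∧
      (∀ ξ, ‖g ξ‖ ≤ Real.exp (M * t)) ∧ ∀ ξ, g ξ = Complex.exp (((t : ℝ) : ℂ) * z ξ) := by
    intro t
    obtain ⟨k, m, hk, ht⟩ := t.2
    refine ⟨proj Z m ^ k, ?_, fun ξ => ?_, fun ξ => ?_⟩
    · rw [dyadic_eq_pow hadd hk ht, hq, map_pow]
    · rw [ContinuousMap.pow_apply, norm_pow, ht]
      refine (pow_le_pow_left₀ (norm_nonneg _) (norm_proj_le hM m ξ) k).trans_eq ?_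
      rw [← Real.exp_nat_mul]
      congr 1
      ring
    · rw [ContinuousMap.pow_apply, hz, ← Complex.exp_nat_mul, ht]
      congr 1
      push_cast
      ring
  choose g hgq hgM hgz using hg
  have hQ : ∀ t, calkinRep H V (q t) = ρ (g t) := fun t => by rw [hgq]; rfl
  have h0 : Tendsto (fun t : Dyadics => (t : ℝ)) (comap Dyadics.toNNReal (𝓝 0)) (𝓝 0) :=
    (((NNReal.continuous_coe.tendsto 0).comp tendsto_comap)).congr Dyadics.coe_toNNReal
  refine exists_isC0Semigroup (Q := fun t => calkinRep H V (q t)) hM0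
    (fun s t => by simp only [hadd, map_mul]) (fun t => ?_) fun x => ?_
  · rw [hQ]
    exact (NonUnitalStarAlgHom.norm_apply_le ρ (g t)).trans
      ((ContinuousMap.norm_le _ (Real.exp_pos _).le).2 (hgM t))
  · simp only [hQ]
    refine tendsto_rep_apply_of_bounded ρ (C := Real.exp M) ?_ (fun ξ => ?_) x
    · filter_upwards [h0.eventually (gt_mem_nhds one_pos)] with t ht ξ
      refine (hgM t ξ).trans (Real.exp_le_exp.2 ?_)
      nlinarith
    · simp only [hgz]
      have h1 : Tendsto (fun t : Dyadics => Complex.exp (((t : ℝ) : ℂ) * z ξ))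
          (comap Dyadics.toNNReal (𝓝 0)) (𝓝 (Complex.exp (((0 : ℝ) : ℂ) * z ξ))) :=
        ((by fun_prop : Continuous fun r : ℝ => Complex.exp ((r : ℂ) * z ξ)).tendsto 0).comp h0
      simpa using h1

/-! ### Joint eigenvectors for the trivial extension -/

theorem exists_orthonormal_nat {E : Type*} [NormedAddCommGroup E] [InnerProductSpace ℂ E]
    (hE : ¬ FiniteDimensional ℂ E) : ∃ b : ℕ → E, Orthonormal ℂ b := by
  let B := Module.Basis.ofVectorSpace ℂ E
  have hinf : Infinite (Module.Basis.ofVectorSpaceIndex ℂ E) := by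
    by_contra h
    rw [not_infinite_iff_finite] at h
    exact hE (Module.Basis.finiteDimensional_of_finite B)
  exact ⟨_, InnerProductSpace.gramSchmidtNormed_orthonormal
    (B.linearIndependent.comp _ (Infinite.natEmbedding _).injective)⟩

/-- Orthonormal sequences are weakly null, by Bessel's inequality. -/
theorem mem_weaklyNull_of_orthonormal {E : Type*} [NormedAddCommGroup E] [InnerProductSpace ℂ E]
    {e : ℕ → E} (he : Orthonormal ℂ e) : e ∈ weaklyNull E := by
  intro y
  have h := (he.inner_products_summable y).tendsto_atTop_zero
  rw [tendsto_zero_iff_norm_tendsto_zero]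
  have h2 := (Real.continuous_sqrt.tendsto 0).comp h
  rw [Real.sqrt_zero] at h2
  refine h2.congr fun n => ?_
  simp only [Function.comp_apply, Real.sqrt_sq (norm_nonneg _)]
  exact norm_inner_symm _ _

/-- If `Γ` is the zero element, then in the `U`-Calkin representation every point `ξ` of `X` is
a joint eigenvalue. An eigenvector is the class of an orthonormal sequence `(e_k)`
with `e_k` in the summand of `H` belonging to `ξ_{i_k}`, where `ξ_{i_k} → ξ`. -/
theorem Ext.IsZero.exists_eigenvector {X : Type*} [TopologicalSpace X] [FirstCountableTopology X]
    {Γ : Ext H X} (hΓ : Γ.IsZero) {τ : BusbyInvariant H X} (hτ : Γ = Quotient.mk _ τ)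
    (U : NonprincipalUltrafilter) (ξ : X) :
    ∃ y : CalkinSpace H U, y ≠ 0 ∧ ∀ g : C(X, ℂ), calkinRep H U (τ.toHom g) y = g ξ • y := by
  obtain ⟨K, p, σ, τ₀, -, hinf, horth, -, hdense, hσ, hτ₀, hΓ₀⟩ := hΓ
  obtain ⟨W, hW, hconj⟩ : τ₀ ≈ τ := Quotient.exact (hΓ₀.symm.trans hτ)
  choose b hb using fun i => exists_orthonormal_nat (hinf i)
  obtain ⟨s, hs, hsξ⟩ := mem_closure_iff_seq_limit.1 (hdense ξ)
  choose i hi using hs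
  let e : ℕ → H := fun k => b (i k) k
  have he : Orthonormal ℂ e := by
    refine ⟨fun k => (hb (i k)).1 k, fun k l hkl => ?_⟩
    by_cases h : i k = i l
    · have : e l = b (i k) l := by rw [h]
      change inner ℂ (e k) (e l) = 0
      rw [this]
      exact (hb (i k)).2 hkl
    · exact (horth _ _ h).inner_eq (b (i k) k).2 (b (i l) l).2
  let x : PreCalkin H U := ⟨e, mem_weaklyNull_of_orthonormal he⟩
  have hinner : limInner U x x = 1 := by
    refine tendsto_nhds_unique (tendsto_limInner U x x) (tendsto_const_nhds.congr fun n => ?_)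
    change 1 = inner ℂ (e n) (e n)
    rw [inner_self_eq_norm_sq_to_K, he.1 n]
    simp
  have hx0 : (x : CalkinSpace H U) ≠ 0 := by
    intro h
    have h1 : inner ℂ (x : CalkinSpace H U) (x : CalkinSpace H U) = 1 := by
      rw [UniformSpace.Completion.inner_coe, inner_preCalkin, hinner]
    rw [h, inner_zero_left] at h1
    exact zero_ne_one h1
  have hxσ : ∀ g : C(X, ℂ), calkinLift H U (σ g) x = g ξ • (x : CalkinSpace H U) := by
    intro g
    rw [calkinLift_coe, ← UniformSpace.Completion.coe_smul, ← sub_eq_zero,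
      ← UniformSpace.Completion.coe_sub, ← norm_eq_zero, UniformSpace.Completion.norm_coe,
      ← sq_eq_zero_iff, ← inner_self_eq_norm_sq (𝕜 := ℂ), inner_preCalkin]
    set w : PreCalkin H U := preCalkinMap U (σ g) x - g ξ • x
    have hw : ∀ n, w.1 n = (g (s n) - g ξ) • e n := by
      intro n
      have h1 : w.1 n = σ g (e n) - g ξ • e n := rfl
      rw [h1, hσ g (i n) (e n) (b (i n) n).2, hi, sub_smul]
    have hlim : Tendsto w.1 (U.1 : Filter ℕ) (𝓝 0) := by
      rw [tendsto_zero_iff_norm_tendsto_zero]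
      have h1 : Tendsto (fun n => ‖g (s n) - g ξ‖) (U.1 : Filter ℕ) (𝓝 0) := by
        have := (((g.continuous.tendsto ξ).comp hsξ).sub_const (g ξ)).norm
        rw [sub_self, norm_zero] at this
        exact this.mono_left U.le_atTop
      refine h1.congr fun n => ?_
      rw [hw, norm_smul, he.1 n, mul_one]
    have h2 := hlim.inner (𝕜 := ℂ) hlim
    rw [inner_zero_left] at h2
    rw [tendsto_nhds_unique (tendsto_limInner U w w) h2]
    rfl
  have hW1 : calkinLift H U W * calkinLift H U (star W) = 1 := by
    rw [← map_mul, Unitary.mul_star_self_of_mem hW, map_one]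
  have hW2 : calkinLift H U W (calkinLift H U (star W) x) = x :=
    DFunLike.congr_fun hW1 (x : CalkinSpace H U)
  refine ⟨calkinLift H U (star W) x, fun h => hx0 ?_, fun g => ?_⟩
  · rw [← hW2, h, map_zero]
  · rw [hconj, hτ₀, star_toCalkin, ← map_mul, ← map_mul, calkinRep_toCalkin, map_mul, map_mul,
      mul_apply_eq_comp, mul_apply_eq_comp, hW2, hxσ, map_smul]

/-- On a joint eigenvector for `ξ`, the operator representing `q(2⁻ⁿ)` is multiplication by
`π_n(ξ)`, so strong continuity at `0` forces `π_n(ξ) → 1`. -/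
theorem tendsto_proj_of_isStronglyContinuous {Z : Set ℂ} {Θ : Ext H (AdmissibleSpace Z)}
    (hΘ : Θ.IsZero) {q : Dyadics → CalkinAlgebra H} (hq : Θ.Induces q)
    {U : NonprincipalUltrafilter} (h : IsStronglyContinuous (calkinRep H U) q)
    (ξ : AdmissibleSpace Z) : Tendsto (fun n => proj Z n ξ) atTop (𝓝 1) := by
  obtain ⟨τ, hτ, -, hqn⟩ := hq
  obtain ⟨T, hT, hTq⟩ := h
  obtain ⟨y, hy0, hy⟩ := hΘ.exists_eigenvector hτ U ξ
  have h2 : Tendsto (fun n : ℕ => ((twoPowNeg n : Dyadics) : ℝ).toNNReal) atTop (𝓝 0) := by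
    rw [← Real.toNNReal_zero]
    refine (continuous_real_toNNReal.tendsto 0).comp ?_
    change Tendsto (fun n : ℕ => ((1 : ℕ) : ℝ) / 2 ^ n) atTop (𝓝 0)
    exact tendsto_const_nhds.div_atTop (tendsto_pow_atTop_atTop_of_one_lt one_lt_two)
  have h3 : Tendsto (fun n => proj Z n ξ • y) atTop (𝓝 y) := by
    have := ((hT.continuous y).tendsto 0).comp h2
    rw [hT.map_zero] at this
    refine this.congr fun n => ?_
    rw [Function.comp_apply, hTq, hqn, hy]
  have h4 := ((tendsto_const_nhds (x := y)).inner (𝕜 := ℂ) h3).div_const (inner ℂ y y)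
  have hyy : (inner ℂ y y : ℂ) ≠ 0 := inner_self_ne_zero.2 hy0
  rw [div_self hyy] at h4
  refine h4.congr fun n => ?_
  rw [inner_smul_right, mul_div_cancel_right₀ _ hyy]

end

end CalkinSG

theorem theoremA {H : Type*} [NormedAddCommGroup H] [InnerProductSpace ℂ H] [CompleteSpace H]
    [TopologicalSpace.SeparableSpace H] (hH : ¬ FiniteDimensional ℂ H)
    (Z : Set ℂ) (hZ : IsClosed Z) (hbdd : BddAbove (Complex.re '' Z))
    (Θ : CalkinSG.Ext H (CalkinSG.AdmissibleSpace Z)) (hΘ : Θ.IsZero)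
    (q : CalkinSG.Dyadics → CalkinSG.CalkinAlgebra H) (hq : Θ.Induces q)
    (U : CalkinSG.NonprincipalUltrafilter) :
    List.TFAE [
      CalkinSG.IsStronglyContinuous (CalkinSG.calkinRep H U) q,
      ∀ V : CalkinSG.NonprincipalUltrafilter,
        CalkinSG.IsStronglyContinuous (CalkinSG.calkinRep H V) q,
      ∀ ξ : CalkinSG.AdmissibleSpace Z,
        Tendsto (fun n => CalkinSG.proj Z n ξ) atTop (𝓝 1)] := by
  tfae_have 1 → 3 := CalkinSG.tendsto_proj_of_isStronglyContinuous hΘ hq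
  tfae_have 3 → 2 := fun h => by
    obtain ⟨τ, -, hadd, hqn⟩ := hq
    exact CalkinSG.isStronglyContinuous_of_tendsto hbdd hadd hqn h
  tfae_have 2 → 1 := fun h => h U
  tfae_finish
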